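/- Let $C$ be a field of characteristic zero and let $\tilde\partial$ be the $C$-linear derivation on $C[t_1,t_2,t_3]$ with \[ \tilde\partial t_1=t_1(1-t_1^2),\qquad \tilde\partial t_2=t_3-(1-t_1^2)t_2,\qquad \tilde\partial t_3=(1-t_1^2)(t_3-t_2), \] that is, $\tilde\partial=t_1(1-t_1^2)\partial$ where $t_1,t_2,t_3$ model $x$ and the complete elliptic integrals $K(x),E(x)$ and $\partial$ models $\frac{d}{dx}$. Let $<$ be the order on Laurent monomials induced by $M=\left(\begin{smallmatrix}1&0&0\\0&1&1\\0&0&1\end{smallmatrix}\right)$, i.e. $t^\alpha<t^\beta$ if and only if the first nonzero entry of $M(\beta-\alpha)$ is positive; in particular $t_2<t_3<t_1$. Definitions. Consider triples $(P,Q,B)$ with $P,Q\in C[x_1,x_2,x_3][t_1^{\pm1},t_2^{\pm1},t_3^{\pm1}]$ and a condition $B$ on $x=\alpha\in\mathbb N^3$. Such a triple is a reduction rule for $\tilde\partial$ w.r.t. $<$ if (a) for every $\alpha\in\mathbb N^3$ satisfying $B$, both $Q(\alpha,t)t^\alpha$ and $P(\alpha,t)t^\alpha$ are polynomials and $\tilde\partial\big(Q(\alpha,t)t^\alpha\big)=P(\alpha,t)t^\alpha$,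 and (b) the leading monomial of $P$ in $t$ is $1$ and its coefficient in $C[x_1,x_2,x_3]$ does not vanish at any $\alpha\in\mathbb N^3$ satisfying $B$. A monomial $t^\alpha$ is reducible by $(P,Q,B)$ if $\alpha$ satisfies $B$. A set $S$ of reduction rules is a complete reduction system if the polynomials $P(\alpha,t)t^\alpha$, with $(P,Q,B)\in S$ and $\alpha\in\mathbb N^3$ satisfying $B$, span the $C$-vector space $\tilde\partial(C[t_1,t_2,t_3])$, and the leading monomial of every nonzero element of $\tilde\partial(C[t_1,t_2,t_3])$ is reducible by some rule in $S$. Let the generic rule $(P_0,Q_0,B_0)$ be given by \begin{align*} P_0={}&-(x_1-x_2+x_3-2)+x_3t_2t_3^{-1}+x_2t_1^{-2}t_2^{-1}t_3+(x_1-x_2+x_3-2)t_1^{-2}-x_3t_1^{-2}t_2t_3^{-1},\\ Q_0={}&t_1^{-2},\qquad B_0=(x_1\ge2\wedge x_1-x_2+x_3\ne2), \end{align*} and for each integer $k\ge1$ let \begin{align*} P_k={}&\Big(t_3-\frac{t_2}2\Big)^{k-2}\Big((x_1+k-1)t_3-\Big(\frac{x_1}2+k-1\Big)t_2\Big)t_3^{-k+1}\quad(\text{so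 } P_1=x_1),\\ Q_k={}&t_2\Big(t_3-\frac{t_2}2\Big)^{k-1}t_3^{-k},\qquad B_k=(x_3=k\wedge x_1+x_3\ne1\wedge x_2=x_1+k-2). \end{align*} Theorem. (1) $(P_0,Q_0,B_0)$ and all $(P_k,Q_k,B_k)$, $k\ge1$, are reduction rules for $\tilde\partial$ w.r.t. $<$. (2) Together they form a complete reduction system. (3) If a monomial is reducible neither by $(P_0,Q_0,B_0)$ nor by any $(P_k,Q_k,B_k)$, $k\ge1$, then it is not the leading monomial of any element of $\tilde\partial(C[t_1,t_2,t_3])$. (4) If $u\in C[t_1,t_2,t_3]$ is homogeneous of degree $d$ w.r.t. the weights $(0,1,1)$, then so is $\tilde\partial u$ (where $0$ counts as homogeneous of every degree). (5) For every $d\in\mathbb N$, exactly $\max(3,2d+2)$ monomials $t_1^it_2^jt_3^k$ with $j+k=d$ are reducible by none of these rules. -/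

import Mathlib

/-! ### Laurent polynomials with parametrized coefficients -/

/-- Laurent polynomials `R[t₁, …, tₙ, t₁⁻¹, …, tₙ⁻¹]`; exponent vectors lie in `ℤⁿ`. -/
abbrev Laurent (n : ℕ) (R : Type*) [CommRing R] : Type _ :=
  AddMonoidAlgebra R (Fin n → ℤ)

/-- Laurent polynomials in `t` with coefficients in `C[x₁, …, xₙ]`. -/
abbrev ParamLaurent (n : ℕ) (C : Type*) [Field C] : Type _ :=
  Laurent n (MvPolynomial (Fin n) C)

/-- The power `tᵢ ^ m`, `m ∈ ℤ`, as a Laurent polynomial. -/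
noncomputable def tPow {n : ℕ} (R : Type*) [CommRing R] (i : Fin n) (m : ℤ) : Laurent n R :=
  AddMonoidAlgebra.single (Pi.single i m) 1

/-- An exponent vector in `ℕⁿ` viewed in `ℤⁿ`. -/
def zexp {n : ℕ} (α : Fin n →₀ ℕ) : Fin n → ℤ := fun i => (α i : ℤ)

/-- The embedding `C[t₁, …, tₙ] → C[t₁, …, tₙ, t₁⁻¹, …, tₙ⁻¹]`. -/
noncomputable def toLaurent {n : ℕ} (C : Type*) [Field C] :
    MvPolynomial (Fin n) C →ₐ[C] Laurent n C :=
  MvPolynomial.aeval (fun i => tPow C i 1)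

/-- The Laurent polynomial `P(α, t) t^α` over `C`, for `P ∈ C[x][t, t⁻¹]` and `α ∈ ℕⁿ`. -/
noncomputable def instantiate {n : ℕ} {C : Type*} [Field C]
    (P : ParamLaurent n C) (α : Fin n →₀ ℕ) : Laurent n C :=
  AddMonoidAlgebra.mapRingHom (Fin n → ℤ)
      (MvPolynomial.eval (fun i => (α i : C))) P *
    AddMonoidAlgebra.single (zexp α) 1

/-! ### Orders on (Laurent) monomials and leading monomials -/

/-- The order on Laurent monomials induced by a matrix: `t^a < t^b` iff the first nonzero entry
of `M (b - a)` is positive. -/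
def matrixLT {n : ℕ} (M : Matrix (Fin n) (Fin n) ℝ) (a b : Fin n → ℤ) : Prop :=
  ∃ i, 0 < M.mulVec (fun l => ((b l - a l : ℤ) : ℝ)) i ∧
    ∀ j, j < i → M.mulVec (fun l => ((b l - a l : ℤ) : ℝ)) j = 0

/-- A (strict) semigroup order on Laurent monomials, in terms of exponent vectors. -/
structure IsSemigroupOrder {n : ℕ} (lt : (Fin n → ℤ) → (Fin n → ℤ) → Prop) : Prop where
  irrefl : ∀ a, ¬ lt a a
  trans : ∀ a b c, lt a b → lt b c → lt a c
  total : ∀ a b, a ≠ b → lt a b ∨ lt b a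
  add_right : ∀ a b c, lt a b → lt (a + c) (b + c)

/-- `m` is the exponent vector of the leading monomial (in `t`) of the Laurent polynomial `P`;
no `m` is when `P = 0`. -/
def IsLaurentLM {n : ℕ} {R : Type*} [CommRing R] (lt : (Fin n → ℤ) → (Fin n → ℤ) → Prop)
    (P : Laurent n R) (m : Fin n → ℤ) : Prop :=
  P.coeff m ≠ 0 ∧ ∀ m', P.coeff m' ≠ 0 → m' ≠ m → lt m' m

/-- `t^α` is the leading monomial of the polynomial `f`; no `α` satisfies this when `f = 0`. -/
def IsLM {n : ℕ} {C : Type*} [Field C] (lt : (Fin n → ℤ) → (Fin n → ℤ) → Prop)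
    (f : MvPolynomial (Fin n) C) (α : Fin n →₀ ℕ) : Prop :=
  MvPolynomial.coeff α f ≠ 0 ∧
    ∀ β : Fin n →₀ ℕ, MvPolynomial.coeff β f ≠ 0 → β ≠ α → lt (zexp β) (zexp α)

/-! ### Reduction rules and complete reduction systems -/

/-- A triple `(P, Q, B)`; the condition `B` is represented by its truth values on `ℕⁿ`. -/
structure RuleTriple (n : ℕ) (C : Type*) [Field C] where
  P : ParamLaurent n C
  Q : ParamLaurent n C
  B : (Fin n →₀ ℕ) → Prop

/-- `(P, Q, B)` encodes a conditional identity for `L`: if `B` holds at `α`, then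
`P(α, t) t^α` and `Q(α, t) t^α` are polynomials with `L (Q(α, t) t^α) = P(α, t) t^α`. -/
def EncodesConditionalIdentity {n : ℕ} {C : Type*} [Field C]
    (L : MvPolynomial (Fin n) C →ₗ[C] MvPolynomial (Fin n) C) (r : RuleTriple n C) : Prop :=
  ∀ α : Fin n →₀ ℕ, r.B α → ∃ q p : MvPolynomial (Fin n) C,
    toLaurent C q = instantiate r.Q α ∧ toLaurent C p = instantiate r.P α ∧ L q = p

/-- `(P, Q, B)` is a reduction rule for `L`: it encodes a conditional identity, the leading
monomial of `P` in `t` is `1`, and its leading coefficient in `C[x]` does not vanish at any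
`α ∈ ℕⁿ` satisfying `B`. -/
def IsReductionRule {n : ℕ} {C : Type*} [Field C] (lt : (Fin n → ℤ) → (Fin n → ℤ) → Prop)
    (L : MvPolynomial (Fin n) C →ₗ[C] MvPolynomial (Fin n) C) (r : RuleTriple n C) : Prop :=
  EncodesConditionalIdentity L r ∧ IsLaurentLM lt r.P 0 ∧
    ∀ α : Fin n →₀ ℕ, r.B α → MvPolynomial.eval (fun i => (α i : C)) (r.P.coeff 0) ≠ 0

/-- The monomial `t^α` is reducible by the rule `r`. -/
def RuleTriple.Reduces {n : ℕ} {C : Type*} [Field C] (r : RuleTriple n C)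
    (α : Fin n →₀ ℕ) : Prop := r.B α

/-- The linear span of all `P(α, t) t^α` with `(P, Q, B) ∈ S` and `B` satisfied by `α` is the
image of `L`. -/
def IsPrecompleteSystem {n : ℕ} {C : Type*} [Field C]
    (L : MvPolynomial (Fin n) C →ₗ[C] MvPolynomial (Fin n) C) (S : Set (RuleTriple n C)) : Prop :=
  Submodule.span C {p : MvPolynomial (Fin n) C | ∃ r ∈ S, ∃ α : Fin n →₀ ℕ,
    r.B α ∧ toLaurent C p = instantiate r.P α} = LinearMap.range L

/-- `S` is a complete reduction system for `L`: it consists of reduction rules, is precomplete,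
and the leading monomial of every nonzero element of the image of `L` is reducible by `S`. -/
def IsCompleteReductionSystem {n : ℕ} {C : Type*} [Field C]
    (lt : (Fin n → ℤ) → (Fin n → ℤ) → Prop)
    (L : MvPolynomial (Fin n) C →ₗ[C] MvPolynomial (Fin n) C) (S : Set (RuleTriple n C)) : Prop :=
  (∀ r ∈ S, IsReductionRule lt L r) ∧ IsPrecompleteSystem L S ∧
    ∀ f ∈ LinearMap.range L, f ≠ 0 → ∃ α, IsLM lt f α ∧ ∃ r ∈ S, r.Reduces α

/-! ### Complete elliptic integrals

The indices `0, 1, 2` of `Fin 3` stand for `1, 2, 3`, so `X 0, X 1, X 2` are `t₁, t₂, t₃`, which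
model `x, K(x), E(x)`. -/

/-- The derivation `∂̃ = t₁ (1 - t₁²) ∂` on `C[t₁, t₂, t₃]`, where `∂ t₁ = 1`,
`∂ t₂ = (t₃ - (1 - t₁²) t₂) / (t₁ (1 - t₁²))` and `∂ t₃ = (t₃ - t₂) / t₁`. -/
noncomputable def ellipticDeriv (C : Type*) [Field C] :
    Derivation C (MvPolynomial (Fin 3) C) (MvPolynomial (Fin 3) C) :=
  MvPolynomial.mkDerivation C
    ![MvPolynomial.X 0 * (1 - MvPolynomial.X 0 ^ 2),
      MvPolynomial.X 2 - (1 - MvPolynomial.X 0 ^ 2) * MvPolynomial.X 1,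
      (1 - MvPolynomial.X 0 ^ 2) * (MvPolynomial.X 2 - MvPolynomial.X 1)]

/-- The block order with `t₂ < t₃ < t₁`. -/
def ellipticLT : (Fin 3 → ℤ) → (Fin 3 → ℤ) → Prop :=
  matrixLT !![1, 0, 0; 0, 1, 1; 0, 0, 1]

/-- The rule `(P₀, Q₀, B₀)`. -/
noncomputable def genericRule (C : Type*) [Field C] : RuleTriple 3 C :=
  let x : Fin 3 → MvPolynomial (Fin 3) C := MvPolynomial.X
  let t : Fin 3 → ℤ → ParamLaurent 3 C := tPow (MvPolynomial (Fin 3) C)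
  { P := -((x 0 - x 1 + x 2 - 2) • 1) + x 2 • (t 1 1 * t 2 (-1))
        + x 1 • (t 0 (-2) * t 1 (-1) * t 2 1)
        + (x 0 - x 1 + x 2 - 2) • t 0 (-2) - x 2 • (t 0 (-2) * t 1 1 * t 2 (-1))
    Q := t 0 (-2)
    B := fun α => 2 ≤ α 0 ∧ (α 0 : ℤ) - (α 1 : ℤ) + (α 2 : ℤ) ≠ 2 }

/-- `t₃ - t₂ / 2`. -/
noncomputable def ellipticS (C : Type*) [Field C] : ParamLaurent 3 C :=
  let t : Fin 3 → ℤ → ParamLaurent 3 C := tPow (MvPolynomial (Fin 3) C)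
  t 2 1 - (MvPolynomial.C (1 / 2) : MvPolynomial (Fin 3) C) • t 1 1

/-- `(x₁ + k - 1) t₃ - (x₁ / 2 + k - 1) t₂`. -/
noncomputable def ellipticT (C : Type*) [Field C] (k : ℕ) : ParamLaurent 3 C :=
  let x : Fin 3 → MvPolynomial (Fin 3) C := MvPolynomial.X
  let t : Fin 3 → ℤ → ParamLaurent 3 C := tPow (MvPolynomial (Fin 3) C)
  (x 0 + (k : MvPolynomial (Fin 3) C) - 1) • t 2 1
    - (MvPolynomial.C (1 / 2) * x 0 + (k : MvPolynomial (Fin 3) C) - 1) • t 1 1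

/-- `P_k = (t₃ - t₂/2)^(k-2) ((x₁+k-1) t₃ - (x₁/2+k-1) t₂) t₃^(-k+1)` for `k ≥ 1`. For `k = 1`
the second factor is `x₁ (t₃ - t₂/2)`, so that `P₁ = x₁`. -/
noncomputable def ellipticP (C : Type*) [Field C] (k : ℕ) : ParamLaurent 3 C :=
  if k = 1 then (MvPolynomial.X 0 : MvPolynomial (Fin 3) C) • 1
  else ellipticS C ^ (k - 2) * ellipticT C k * tPow _ 2 (-(k : ℤ) + 1)

/-- The rule `(P_k, Q_k, B_k)`, for `k ≥ 1`. -/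
noncomputable def ellipticRule (C : Type*) [Field C] (k : ℕ) : RuleTriple 3 C where
  P := ellipticP C k
  Q := tPow _ 1 1 * ellipticS C ^ (k - 1) * tPow _ 2 (-(k : ℤ))
  B := fun α => α 2 = k ∧ α 0 + α 2 ≠ 1 ∧ (α 1 : ℤ) = (α 0 : ℤ) + (k : ℤ) - 2

/-- The reduction system made of the generic rule and of the rules `(P_k, Q_k, B_k)`, `k ≥ 1`. -/
def ellipticSystem (C : Type*) [Field C] : Set (RuleTriple 3 C) :=
  {genericRule C} ∪ {r | ∃ k : ℕ, 1 ≤ k ∧ r = ellipticRule C k}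

/-- The order is a semigroup order, so that leading monomials of nonzero (Laurent) polynomials
exist and are unique. -/
theorem ellipticLT_isSemigroupOrder : IsSemigroupOrder ellipticLT := by
  have key : ∀ a b : Fin 3 → ℤ, ellipticLT a b ↔
      (a 0 < b 0 ∨ (a 0 = b 0 ∧ (a 1 + a 2 < b 1 + b 2 ∨
        (a 1 + a 2 = b 1 + b 2 ∧ a 2 < b 2)))) := by
    intro a b
    have e1 : ((b 0 : ℝ) - a 0 = 0) ↔ a 0 = b 0 := by
      rw [sub_eq_zero]; norm_cast; exact eq_comm
    have e2 : ((b 1 : ℝ) - a 1 + (b 2 - a 2) = 0) ↔ a 1 + a 2 = b 1 + b 2 := by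
      constructor
      · intro h
        have : ((a 1 + a 2 : ℤ) : ℝ) = ((b 1 + b 2 : ℤ) : ℝ) := by push_cast; linarith
        exact_mod_cast this
      · intro h
        have : ((a 1 + a 2 : ℤ) : ℝ) = ((b 1 + b 2 : ℤ) : ℝ) := by rw [h]
        push_cast at this; linarith
    have e3 : (0 < (b 1 : ℝ) - a 1 + (b 2 - a 2)) ↔ a 1 + a 2 < b 1 + b 2 := by
      constructor
      · intro h
        have : ((a 1 + a 2 : ℤ) : ℝ) < ((b 1 + b 2 : ℤ) : ℝ) := by push_cast; linarith
        exact_mod_cast this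
      · intro h
        have : ((a 1 + a 2 : ℤ) : ℝ) < ((b 1 + b 2 : ℤ) : ℝ) := by exact_mod_cast h
        push_cast at this; linarith
    simp [ellipticLT, matrixLT, Fin.exists_fin_succ, Fin.forall_fin_succ, Matrix.mulVec,
      dotProduct, Fin.sum_univ_three, e1, e2, e3]
    tauto
  refine ⟨fun a => ?_, fun a b c => ?_, fun a b hab => ?_, fun a b c => ?_⟩
  · rw [key]; omega
  · rw [key, key, key]; omega
  · rw [key, key]
    by_contra h
    apply hab
    funext i
    fin_cases i <;> simp <;> omega
  · rw [key, key]
    simp only [Pi.add_apply]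
    omega

/-- The defining formula of `P_k` for all `k ≥ 1`, with the factor `t₃ - t₂/2` cleared. -/
theorem ellipticS_mul_ellipticP (C : Type*) [Field C] [CharZero C] (k : ℕ) (hk : 1 ≤ k) :
    ellipticS C * ellipticP C k
      = ellipticS C ^ (k - 1) * ellipticT C k * tPow _ 2 (-(k : ℤ) + 1) := by
  by_cases h : k = 1
  · subst h
    have h0 : tPow (MvPolynomial (Fin 3) C) (2 : Fin 3) 0 = 1 := by
      simp [tPow, AddMonoidAlgebra.one_def]
    simp [ellipticP, ellipticT, ellipticS, h0, smul_sub, smul_smul, mul_comm]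
  · obtain ⟨m, rfl⟩ : ∃ m, k = m + 2 := ⟨k - 2, by omega⟩
    simp only [ellipticP, if_neg h, Nat.add_sub_cancel, show m + 2 - 1 = m + 1 by omega]
    ring

/-!
The derivation multiplies a monomial by a Laurent polynomial: with `β = (a, b, c)`,
`∂̃ t^β = t^β ((a - b + c) (1 - t₁²) + b t₂⁻¹ t₃ - c (1 - t₁²) t₂ t₃⁻¹)`. If `a - b + c ≠ 0`, the
leading exponent is `β + (2, 0, 0)`, and this is the generic rule
(`toLaurent_ellipticDeriv_monomial`). If `b = a + c`, this coefficient vanishes, and `t^β` is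
replaced by `t₁^a t₂^(a+c) s^c` with `s = t₃ - t₂/2`. As `∂̃ s = (1 - t₁²) s - t₃/2`, the derivative of
this polynomial is free of the factor `1 - t₁²` and has leading exponent
`(a, a + c - 1, c + 1)`; this is the rule with index `k = c + 1`
(`toLaurent_ellipticDeriv_special`). Expanding `s^c` gives `t^β` plus multiples of monomials
`t₁^a t₂^(a+c+j) t₃^(c-j)`, `j ≥ 1`, to which the generic rule applies, so the two kinds of
identities span the image of `∂̃` (`isPrecompleteSystem_ellipticSystem`); the only exponent left
out is `β = 0`, where `∂̃ 1 = 0`.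

The conditions of different rules exclude each other (`ellipticSystem_exclusive`), so the spanning
elements have pairwise distinct leading monomials. Leading terms then cannot cancel in a linear
combination (`exists_isLM_of_mem_span`), which gives completeness and shows that irreducible
monomials are never leading monomials of elements of the image. Leading monomials of the `P_k` are
computed from their factors, by multiplicativity of leading terms (`LeadsWith.mul`). The count of
irreducible monomials is linear arithmetic on the conditions (`not_reduces_iff`).
-/

/-! ### Leading terms of Laurent polynomials -/

/-- The Laurent polynomial `P` is `c t^m` plus terms below `t^m`. The coefficient `c` may
vanish, so that the notion is stable under products over any ring of coefficients and under
change of coefficients. -/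
structure LeadsWith {n : ℕ} {R : Type*} [CommRing R] (lt : (Fin n → ℤ) → (Fin n → ℤ) → Prop)
    (P : Laurent n R) (m : Fin n → ℤ) (c : R) : Prop where
  coeff_eq : P.coeff m = c
  lt_of_ne : ∀ m', P.coeff m' ≠ 0 → m' ≠ m → lt m' m

section LeadsWith

variable {n : ℕ} {R S : Type*} [CommRing R] [CommRing S]
  {lt : (Fin n → ℤ) → (Fin n → ℤ) → Prop}

theorem LeadsWith.isLaurentLM {P : Laurent n R} {m : Fin n → ℤ} {c : R}
    (h : LeadsWith lt P m c) (hc : c ≠ 0) : IsLaurentLM lt P m :=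
  ⟨h.coeff_eq ▸ hc, h.lt_of_ne⟩

theorem LeadsWith.single (m : Fin n → ℤ) (c : R) :
    LeadsWith lt (AddMonoidAlgebra.single m c) m c := by
  refine ⟨by simp, fun m' h hne => absurd ?_ h⟩
  simp [Finsupp.single_eq_of_ne hne]

theorem LeadsWith.map {P : Laurent n R} {m : Fin n → ℤ} {c : R} (h : LeadsWith lt P m c)
    (f : R →+* S) :
    LeadsWith lt (AddMonoidAlgebra.mapRingHom (Fin n → ℤ) f P) m (f c) := by
  refine ⟨by simp [h.coeff_eq], fun m' hm' hne => h.lt_of_ne m' (fun h0 => hm' ?_) hne⟩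
  simp [h0]

theorem LeadsWith.smul {P : Laurent n R} {m : Fin n → ℤ} {c : R} (h : LeadsWith lt P m c)
    (r : R) : LeadsWith lt (r • P) m (r * c) := by
  refine ⟨by simp [h.coeff_eq], fun m' hm' hne => h.lt_of_ne m' (fun h0 => hm' ?_) hne⟩
  simp [h0]

theorem LeadsWith.add_of_lt (hlt : IsSemigroupOrder lt) {P Q : Laurent n R} {m k : Fin n → ℤ}
    {c d : R} (hP : LeadsWith lt P m c) (hQ : LeadsWith lt Q k d) (hk : lt k m) :
    LeadsWith lt (P + Q) m c := by
  have hQm : ∀ m', Q.coeff m' ≠ 0 → lt m' m := fun m' h => by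
    by_cases e : m' = k
    · exact e ▸ hk
    · exact hlt.trans _ _ _ (hQ.lt_of_ne m' h e) hk
  refine ⟨?_, fun m' h hne => ?_⟩
  · have : Q.coeff m = 0 := by
      by_contra h
      exact hlt.irrefl _ (hQm m h)
    simp [hP.coeff_eq, this]
  · by_cases h0 : P.coeff m' = 0
    · exact hQm m' fun h1 => h (by simp [h0, h1])
    · exact hP.lt_of_ne m' h0 hne

theorem LeadsWith.mul (hlt : IsSemigroupOrder lt) {P Q : Laurent n R} {m k : Fin n → ℤ}
    {c d : R} (hP : LeadsWith lt P m c) (hQ : LeadsWith lt Q k d) :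
    LeadsWith lt (P * Q) (m + k) (c * d) := by
  have hlt' : ∀ a b, P.coeff a ≠ 0 → Q.coeff b ≠ 0 → ¬ (a = m ∧ b = k) →
      lt (a + b) (m + k) := by
    intro a b ha hb hne
    by_cases ea : a = m
    · have eb : b ≠ k := fun eb => hne ⟨ea, eb⟩
      subst ea
      simpa [add_comm] using hlt.add_right _ _ a (hQ.lt_of_ne b hb eb)
    · have h1 := hlt.add_right _ _ b (hP.lt_of_ne a ha ea)
      by_cases eb : b = k
      · exact eb ▸ h1
      · refine hlt.trans _ _ _ h1 ?_
        simpa [add_comm] using hlt.add_right _ _ m (hQ.lt_of_ne b hb eb)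
  refine ⟨?_, fun m' h hne => ?_⟩
  · rw [AddMonoidAlgebra.coeff_mul_add_of_uniqueAdd, hP.coeff_eq, hQ.coeff_eq]
    intro a b ha hb hab
    by_contra hne
    have := hlt' a b (Finsupp.mem_support_iff.1 ha) (Finsupp.mem_support_iff.1 hb) hne
    rw [hab] at this
    exact hlt.irrefl _ this
  · classical
    obtain ⟨a, ha, b, hb, rfl⟩ := Finset.mem_add.1
      (AddMonoidAlgebra.support_coeff_mul_subset P Q (Finsupp.mem_support_iff.2 h))
    refine hlt' a b (Finsupp.mem_support_iff.1 ha) (Finsupp.mem_support_iff.1 hb) ?_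
    rintro ⟨rfl, rfl⟩
    exact hne rfl

theorem LeadsWith.pow (hlt : IsSemigroupOrder lt) {P : Laurent n R} {m : Fin n → ℤ}
    {c : R} (hP : LeadsWith lt P m c) (k : ℕ) : LeadsWith lt (P ^ k) (k • m) (c ^ k) := by
  induction k with
  | zero => simpa [AddMonoidAlgebra.one_def] using LeadsWith.single (lt := lt) 0 (1 : R)
  | succ k ih =>
    rw [pow_succ, pow_succ, succ_nsmul]
    exact ih.mul hlt hP

end LeadsWith

/-! ### Polynomials as Laurent polynomials -/

section ToLaurent

variable {n : ℕ} {C : Type*} [Field C]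

theorem zexp_injective : Function.Injective (zexp : (Fin n →₀ ℕ) → Fin n → ℤ) := by
  intro a b h
  ext i
  have := congrFun h i
  simpa [zexp] using this

theorem toLaurent_monomial (α : Fin n →₀ ℕ) (c : C) :
    toLaurent C (MvPolynomial.monomial α c) = AddMonoidAlgebra.single (zexp α) c := by
  have h : ∀ i (k : ℕ), tPow C i (1 : ℤ) ^ k = tPow (n := n) C i k := by
    intro i k
    simp [tPow, AddMonoidAlgebra.single_pow, ← Pi.single_smul]
  have h2 : ∀ s : Finset (Fin n), ∏ i ∈ s, tPow C i (α i : ℤ)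
      = AddMonoidAlgebra.single (∑ i ∈ s, Pi.single i (α i : ℤ)) 1 := by
    intro s
    induction s using Finset.cons_induction with
    | empty => simp [AddMonoidAlgebra.one_def]
    | cons a s has ih =>
      rw [Finset.prod_cons, Finset.sum_cons, ih, tPow, AddMonoidAlgebra.single_mul_single, one_mul]
  rw [toLaurent, MvPolynomial.aeval_monomial, Finsupp.prod_fintype _ _ (by simp)]
  simp_rw [h]
  rw [h2, Finset.univ_sum_single]
  simp [AddMonoidAlgebra.single_mul_single]
  rfl

theorem coeff_toLaurent (p : MvPolynomial (Fin n) C) (α : Fin n →₀ ℕ) :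
    (toLaurent C p).coeff (zexp α) = MvPolynomial.coeff α p := by
  induction p using MvPolynomial.induction_on' with
  | monomial β c =>
    classical
    rw [toLaurent_monomial, AddMonoidAlgebra.coeff_single, Finsupp.single_apply,
      MvPolynomial.coeff_monomial]
    simp [zexp_injective.eq_iff]
  | add p q hp hq => simp [hp, hq]

theorem toLaurent_injective :
    Function.Injective (toLaurent C : MvPolynomial (Fin n) C → Laurent n C) := by
  intro p q h
  ext α
  rw [← coeff_toLaurent, h, coeff_toLaurent]

end ToLaurent

/-! ### Leading monomials in the span of polynomials with distinct leading monomials -/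

section LeadingMonomials

variable {n : ℕ} {C : Type*} [Field C] {lt : (Fin n → ℤ) → (Fin n → ℤ) → Prop}

theorem IsLM.unique (hlt : IsSemigroupOrder lt) {f : MvPolynomial (Fin n) C}
    {α β : Fin n →₀ ℕ} (hα : IsLM lt f α) (hβ : IsLM lt f β) : α = β := by
  by_contra h
  exact hlt.irrefl _ (hlt.trans _ _ _ (hα.2 β hβ.1 (Ne.symm h)) (hβ.2 α hα.1 h))

/-- The leading monomial of the identity obtained from a reduction rule at `α` is `t^α`. -/
theorem IsReductionRule.isLM (hlt : IsSemigroupOrder lt)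
    {L : MvPolynomial (Fin n) C →ₗ[C] MvPolynomial (Fin n) C} {r : RuleTriple n C}
    (hr : IsReductionRule lt L r) {α : Fin n →₀ ℕ} (hα : r.B α) {p : MvPolynomial (Fin n) C}
    (hp : toLaurent C p = instantiate r.P α) : IsLM lt p α := by
  have hP : LeadsWith lt r.P 0 (r.P.coeff 0) := ⟨rfl, hr.2.1.2⟩
  have h := (hP.map (MvPolynomial.eval fun i => (α i : C))).mul hlt
    (LeadsWith.single (zexp α) 1)
  rw [zero_add, mul_one] at h
  change LeadsWith lt (instantiate r.P α) _ _ at h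
  rw [← hp] at h
  refine ⟨?_, fun β hβ hne => h.lt_of_ne _ ?_ (zexp_injective.ne hne)⟩
  · rw [← coeff_toLaurent, h.coeff_eq]
    exact hr.2.2 α hα
  · rwa [coeff_toLaurent]

theorem IsSemigroupOrder.exists_max (hlt : IsSemigroupOrder lt) {ι : Type*} (s : Finset ι)
    (hs : s.Nonempty) (g : ι → Fin n → ℤ) (hg : Set.InjOn g s) :
    ∃ i ∈ s, ∀ j ∈ s, j ≠ i → lt (g j) (g i) := by
  induction hs using Finset.Nonempty.cons_induction with
  | singleton a => exact ⟨a, by simp, by simp⟩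
  | cons a s has hs ih =>
    obtain ⟨i, hi, hmax⟩ := ih (hg.mono (by simp))
    have hne : i ≠ a := fun h => has (h ▸ hi)
    have hgne : g a ≠ g i := fun h =>
      hne (hg (by simp [hi]) (by simp) h.symm)
    rcases hlt.total _ _ hgne with h | h
    · refine ⟨i, by simp [hi], fun j hj hji => ?_⟩
      rcases Finset.mem_cons.1 hj with rfl | hj
      · exact h
      · exact hmax j hj hji
    · refine ⟨a, by simp, fun j hj hja => ?_⟩
      rcases Finset.mem_cons.1 hj with rfl | hj
      · exact absurd rfl hja
      · by_cases e : j = i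
        · exact e ▸ h
        · exact hlt.trans _ _ _ (hmax j hj e) h

/-- If the members of `T` have pairwise distinct leading monomials, then a nonzero element of the
span of `T` has the leading monomial of a member of `T`, since leading terms cannot cancel. -/
theorem exists_isLM_of_mem_span (hlt : IsSemigroupOrder lt) {T : Set (MvPolynomial (Fin n) C)}
    (lm : MvPolynomial (Fin n) C → Fin n →₀ ℕ) (hlm : ∀ p ∈ T, IsLM lt p (lm p))
    (hinj : Set.InjOn lm T) {f : MvPolynomial (Fin n) C} (hf : f ∈ Submodule.span C T)
    (hf0 : f ≠ 0) : ∃ p ∈ T, IsLM lt f (lm p) := by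
  obtain ⟨c, hcT, rfl⟩ := Submodule.mem_span_set.1 hf
  have hs : c.support.Nonempty := by
    rw [Finsupp.support_nonempty_iff]
    rintro rfl
    simp at hf0
  obtain ⟨p, hp, hmax⟩ := hlt.exists_max c.support hs (fun q => zexp (lm q))
    (fun a ha b hb h => hinj (hcT ha) (hcT hb) (zexp_injective h))
  have hcoeff : ∀ β, MvPolynomial.coeff β (c.sum fun q a => a • q)
      = ∑ q ∈ c.support, c q * MvPolynomial.coeff β q := fun β => by
    simp [Finsupp.sum, MvPolynomial.coeff_sum]
  refine ⟨p, hcT hp, ?_, fun β hβ hne => ?_⟩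
  · rw [hcoeff, Finset.sum_eq_single p]
    · exact mul_ne_zero (Finsupp.mem_support_iff.1 hp) (hlm p (hcT hp)).1
    · intro q hq hqp
      by_contra h
      have hlt1 := hmax q hq hqp
      have hne : lm p ≠ lm q := fun e => by
        rw [e] at hlt1
        exact hlt.irrefl _ hlt1
      exact hlt.irrefl _ (hlt.trans _ _ _ hlt1
        ((hlm q (hcT hq)).2 _ (right_ne_zero_of_mul h) hne))
    · exact fun h => absurd hp h
  · rw [hcoeff] at hβ
    obtain ⟨q, hq, h⟩ := Finset.exists_ne_zero_of_sum_ne_zero hβ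
    have hqβ := right_ne_zero_of_mul h
    by_cases e : q = p
    · exact (hlm p (hcT hp)).2 β (e ▸ hqβ) hne
    · by_cases e' : β = lm q
      · exact e' ▸ hmax q hq e
      · exact hlt.trans _ _ _ ((hlm q (hcT hq)).2 β hqβ e') (hmax q hq e)

/-- A precomplete system of reduction rules with mutually exclusive conditions is complete. -/
theorem isCompleteReductionSystem_of_exclusive (hlt : IsSemigroupOrder lt)
    {L : MvPolynomial (Fin n) C →ₗ[C] MvPolynomial (Fin n) C} {S : Set (RuleTriple n C)}
    (hS : ∀ r ∈ S, IsReductionRule lt L r) (hspan : IsPrecompleteSystem L S)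
    (hexcl : ∀ r ∈ S, ∀ r' ∈ S, ∀ α, r.B α → r'.B α → r = r') :
    IsCompleteReductionSystem lt L S := by
  refine ⟨hS, hspan, fun f hf hf0 => ?_⟩
  rw [← hspan] at hf
  have : Nonempty (RuleTriple n C) := ⟨⟨0, 0, fun _ => False⟩⟩
  choose! r hr lm hlm hP using fun (p : MvPolynomial (Fin n) C)
    (hp : p ∈ {p | ∃ r ∈ S, ∃ α : Fin n →₀ ℕ, r.B α ∧ toLaurent C p = instantiate r.P α}) => hp
  obtain ⟨p, hp, h⟩ := exists_isLM_of_mem_span hlt lm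
    (fun p hp => (hS _ (hr p hp)).isLM hlt (hlm p hp) (hP p hp))
    (fun p hp q hq e => by
      have hrr : r p = r q := hexcl _ (hr p hp) _ (hr q hq) (lm p) (hlm p hp) (e ▸ hlm q hq)
      exact toLaurent_injective (by rw [hP p hp, hP q hq, hrr, e])) hf hf0
  exact ⟨lm p, h, r p, hr p hp, hlm p hp⟩

end LeadingMonomials

/-! ### The order `t₂ < t₃ < t₁` -/

theorem ellipticLT_of_lt_zero {a b : Fin 3 → ℤ} (h : a 0 < b 0) : ellipticLT a b := by
  refine ⟨0, ?_, fun j hj => absurd hj (Fin.not_lt_zero j)⟩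
  have : (a 0 : ℝ) < b 0 := by exact_mod_cast h
  simpa [Matrix.mulVec, dotProduct, Fin.sum_univ_three] using this

theorem ellipticLT_of_lt_two {a b : Fin 3 → ℤ} (h0 : a 0 = b 0) (h1 : a 1 + a 2 = b 1 + b 2)
    (h2 : a 2 < b 2) : ellipticLT a b := by
  have h1' : (a 1 : ℝ) + a 2 = b 1 + b 2 := by exact_mod_cast h1
  have h2' : (a 2 : ℝ) < b 2 := by exact_mod_cast h2
  refine ⟨2, ?_, fun j hj => ?_⟩
  · simpa [Matrix.mulVec, dotProduct, Fin.sum_univ_three] using h2'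
  · fin_cases j
    · simp [Matrix.mulVec, dotProduct, Fin.sum_univ_three, h0]
    · simp [Matrix.mulVec, dotProduct, Fin.sum_univ_three]
      linarith
    · exact absurd hj (lt_irrefl _)

/-! ### Leading terms of the rules -/

section Leading

variable {R : Type*} [CommRing R]

theorem leadsWith_tPow {n : ℕ} {lt : (Fin n → ℤ) → (Fin n → ℤ) → Prop} (i : Fin n) (m : ℤ) :
    LeadsWith lt (tPow R i m) (Pi.single i m) 1 :=
  LeadsWith.single _ _

theorem leadsWith_tPow_sub (c d : R) :
    LeadsWith ellipticLT (c • tPow R 2 1 - d • tPow R 1 1) (Pi.single 2 1) c := by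
  have h := ((leadsWith_tPow (R := R) (lt := ellipticLT) 2 1).smul c).add_of_lt
    ellipticLT_isSemigroupOrder ((leadsWith_tPow (R := R) 1 1).smul (-d))
    (ellipticLT_of_lt_two (by simp) (by simp) (by simp))
  simpa [sub_eq_add_neg] using h

variable (C : Type*) [Field C]

theorem leadsWith_genericRule :
    LeadsWith ellipticLT (genericRule C).P 0
      (-(MvPolynomial.X 0 - MvPolynomial.X 1 + MvPolynomial.X 2 - 2)) := by
  have hlt := ellipticLT_isSemigroupOrder
  have ht := fun i m => leadsWith_tPow (R := MvPolynomial (Fin 3) C) (lt := ellipticLT) i m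
  have h1 : LeadsWith ellipticLT (1 : ParamLaurent 3 C) 0 1 := LeadsWith.single 0 1
  have h := ((((h1.smul (-(MvPolynomial.X 0 - MvPolynomial.X 1 + MvPolynomial.X 2 - 2))).add_of_lt
    hlt (((ht 1 1).mul hlt (ht 2 (-1))).smul (MvPolynomial.X 2))
      (ellipticLT_of_lt_two (by simp) (by simp) (by simp))).add_of_lt
    hlt ((((ht 0 (-2)).mul hlt (ht 1 (-1))).mul hlt (ht 2 1)).smul (MvPolynomial.X 1))
      (ellipticLT_of_lt_zero (by simp))).add_of_lt
    hlt ((ht 0 (-2)).smul (MvPolynomial.X 0 - MvPolynomial.X 1 + MvPolynomial.X 2 - 2))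
      (ellipticLT_of_lt_zero (by simp))).add_of_lt
    hlt ((((ht 0 (-2)).mul hlt (ht 1 1)).mul hlt (ht 2 (-1))).smul (-MvPolynomial.X 2))
      (ellipticLT_of_lt_zero (by simp))
  rw [mul_one, neg_smul, neg_smul, ← sub_eq_add_neg] at h
  exact h

theorem leadsWith_ellipticP (k : ℕ) (hk : 1 ≤ k) :
    LeadsWith ellipticLT (ellipticP C k) 0
      (MvPolynomial.X 0 + (k : MvPolynomial (Fin 3) C) - 1) := by
  have hlt := ellipticLT_isSemigroupOrder
  by_cases h : k = 1
  · subst h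
    have h1 : LeadsWith ellipticLT (1 : ParamLaurent 3 C) 0 1 := LeadsWith.single 0 1
    simpa [ellipticP] using h1.smul (MvPolynomial.X 0)
  · obtain ⟨m, rfl⟩ : ∃ m, k = m + 2 := ⟨k - 2, by omega⟩
    have hS : LeadsWith ellipticLT (ellipticS C) (Pi.single 2 1) 1 := by
      simpa [ellipticS] using leadsWith_tPow_sub (1 : MvPolynomial (Fin 3) C)
        (MvPolynomial.C (1 / 2))
    have hT := ((hS.pow hlt m).mul hlt (leadsWith_tPow_sub
      (MvPolynomial.X 0 + ((m + 2 : ℕ) : MvPolynomial (Fin 3) C) - 1)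
      (MvPolynomial.C (1 / 2) * MvPolynomial.X 0 + ((m + 2 : ℕ) : MvPolynomial (Fin 3) C) - 1))).mul
      hlt (leadsWith_tPow 2 (-((m + 2 : ℕ) : ℤ) + 1))
    have e : m • (Pi.single 2 1 : Fin 3 → ℤ) + Pi.single 2 1
        + Pi.single 2 (-((m + 2 : ℕ) : ℤ) + 1) = 0 := by
      funext i
      fin_cases i <;> simp
      ring
    rw [e, one_pow, one_mul, mul_one] at hT
    rw [ellipticP, if_neg h]
    exact hT

end Leading

/-! ### The rules as identities for the derivation -/

/-- The exponent vector `(a, b, c)`. -/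
noncomputable def expVec (a b c : ℕ) : Fin 3 →₀ ℕ := Finsupp.equivFunOnFinite.symm ![a, b, c]

@[simp] theorem expVec_zero (a b c : ℕ) : expVec a b c 0 = a := rfl
@[simp] theorem expVec_one (a b c : ℕ) : expVec a b c 1 = b := rfl
@[simp] theorem expVec_two (a b c : ℕ) : expVec a b c 2 = c := rfl

theorem expVec_self (α : Fin 3 →₀ ℕ) : expVec (α 0) (α 1) (α 2) = α := by
  ext i
  fin_cases i <;> rfl

section Identities

variable {C : Type*} [Field C]

theorem tPow_natCast {n : ℕ} {R : Type*} [CommRing R] (i : Fin n) (m : ℤ) (k : ℕ) :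
    tPow R i (k * m) = tPow R i m ^ k := by
  simp [tPow, AddMonoidAlgebra.single_pow, ← Pi.single_smul]

theorem tPow_add {n : ℕ} {R : Type*} [CommRing R] (i : Fin n) (m k : ℤ) :
    tPow R i (m + k) = tPow R i m * tPow R i k := by
  simp [tPow, AddMonoidAlgebra.single_mul_single, Pi.single_add]

theorem tPow_mul_tPow_neg {n : ℕ} {R : Type*} [CommRing R] (i : Fin n) (m : ℤ) :
    tPow R i m * tPow R i (-m) = 1 := by
  rw [← tPow_add]
  simp [tPow, AddMonoidAlgebra.one_def]

theorem mapRingHom_tPow {n : ℕ} {R S : Type*} [CommRing R] [CommRing S] (f : R →+* S)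
    (i : Fin n) (m : ℤ) :
    AddMonoidAlgebra.mapRingHom (Fin n → ℤ) f (tPow R i m) = tPow S i m := by
  simp [tPow]

theorem mapRingHom_smul {n : ℕ} {R S : Type*} [CommRing R] [CommRing S] (f : R →+* S)
    (r : R) (P : Laurent n R) :
    AddMonoidAlgebra.mapRingHom (Fin n → ℤ) f (r • P)
      = algebraMap S (Laurent n S) (f r) * AddMonoidAlgebra.mapRingHom (Fin n → ℤ) f P := by
  rw [← Algebra.smul_def]
  ext
  simp

theorem monomial_eq_X_pow (α : Fin 3 →₀ ℕ) (c : C) :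
    MvPolynomial.monomial α c
      = c • (MvPolynomial.X 0 ^ α 0 * MvPolynomial.X 1 ^ α 1 * MvPolynomial.X 2 ^ α 2) := by
  rw [MvPolynomial.monomial_eq, Finsupp.prod_fintype _ _ (by simp), Fin.prod_univ_three,
    MvPolynomial.smul_eq_C_mul]

theorem toLaurent_X {n : ℕ} (i : Fin n) : toLaurent C (MvPolynomial.X i) = tPow C i 1 := by
  simp [toLaurent]

theorem instantiate_eq (P : ParamLaurent 3 C) (α : Fin 3 →₀ ℕ) :
    instantiate P α = AddMonoidAlgebra.mapRingHom (Fin 3 → ℤ)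
      (MvPolynomial.eval (fun i => (α i : C))) P *
        (tPow C 0 1 ^ α 0 * tPow C 1 1 ^ α 1 * tPow C 2 1 ^ α 2) := by
  rw [instantiate, ← toLaurent_monomial, monomial_eq_X_pow]
  simp [toLaurent_X]

theorem ellipticDeriv_X (i : Fin 3) : ellipticDeriv C (MvPolynomial.X i) =
    (![MvPolynomial.X 0 * (1 - MvPolynomial.X 0 ^ 2),
      MvPolynomial.X 2 - (1 - MvPolynomial.X 0 ^ 2) * MvPolynomial.X 1,
      (1 - MvPolynomial.X 0 ^ 2) * (MvPolynomial.X 2 - MvPolynomial.X 1)] :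
      Fin 3 → MvPolynomial (Fin 3) C) i :=
  MvPolynomial.mkDerivation_X _ _ _

/-- The truncated exponent in the derivative of a power, rewritten for a unit `u` with inverse `v`;
this holds also for `n = 0`. -/
theorem natCast_mul_pow_pred {A : Type*} [CommRing A] {u v : A} (h : u * v = 1) (n : ℕ) :
    (n : A) * u ^ (n - 1) = n * (u ^ n * v) := by
  cases n with
  | zero => simp
  | succ n =>
    rw [Nat.add_sub_cancel, pow_succ]
    linear_combination (-((n + 1 : ℕ) : A) * u ^ n) * h

/-- The derivative of `t₁^a t₂^b t₃^c` is the instance of the generic rule at `(a + 2, b, c)`,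
without any condition on `a`, `b`, `c`. -/
theorem toLaurent_ellipticDeriv_monomial (a b c : ℕ) :
    toLaurent C (ellipticDeriv C
      (MvPolynomial.X 0 ^ a * MvPolynomial.X 1 ^ b * MvPolynomial.X 2 ^ c))
      = instantiate (genericRule C).P (expVec (a + 2) b c) := by
  have e : tPow C (0 : Fin 3) (-2) = tPow C 0 (-1) ^ 2 := by
    rw [← tPow_natCast]; norm_num
  have h0 := tPow_mul_tPow_neg (R := C) (0 : Fin 3) 1
  have h1 := tPow_mul_tPow_neg (R := C) (1 : Fin 3) 1
  have h2 := tPow_mul_tPow_neg (R := C) (2 : Fin 3) 1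
  have hb := natCast_mul_pow_pred h1 b
  rw [instantiate_eq]
  simp only [genericRule, map_add, map_sub, map_neg, mapRingHom_smul, map_mul, mapRingHom_tPow,
    map_one, e, Derivation.leibniz, Derivation.leibniz_pow, ellipticDeriv_X, toLaurent_X, map_pow,
    smul_eq_mul, nsmul_eq_mul, map_natCast, MvPolynomial.eval_X, expVec_zero, expVec_one,
    expVec_two, map_ofNat, Nat.cast_add, Nat.cast_ofNat, Matrix.cons_val]
  have ha := natCast_mul_pow_pred h0 a
  have hc := natCast_mul_pow_pred h2 c
  generalize tPow C (0 : Fin 3) 1 = u0 at *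
  generalize tPow C (1 : Fin 3) 1 = u1 at *
  generalize tPow C (2 : Fin 3) 1 = u2 at *
  generalize tPow C (0 : Fin 3) (-1) = v0 at *
  generalize tPow C (1 : Fin 3) (-1) = v1 at *
  generalize tPow C (2 : Fin 3) (-1) = v2 at *
  have h0' : u0 ^ 2 * v0 ^ 2 = 1 := by rw [← mul_pow, h0, one_pow]
  linear_combination (u2 ^ c * u1 ^ b * (u0 * (1 - u0 ^ 2))) * ha
    + (u2 ^ c * u0 ^ a * (u2 - (1 - u0 ^ 2) * u1)) * hb
    + (u0 ^ a * u1 ^ b * ((1 - u0 ^ 2) * (u2 - u1))) * hc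
    + (u0 ^ a * u1 ^ b * u2 ^ c * (1 - u0 ^ 2)) * (a * h0 - b * h1 + c * h2)
    - (u0 ^ a * u1 ^ b * u2 ^ c * (b * v1 * u2 + (a - b + c) - c * u1 * v2)) * h0'

/-- The derivative of `t₁^a t₂^(b+1) (t₃ - t₂/2)^(k-1)` is the instance of the rule with index `k`
at `(a, b, k)`. The relation `b + 2 = a + k` cancels all terms with a factor `1 - t₁²`. -/
theorem toLaurent_ellipticDeriv_special [CharZero C] (k a b : ℕ) (hk : 1 ≤ k)
    (hb : b + 2 = a + k) :
    toLaurent C (ellipticDeriv C (MvPolynomial.X 0 ^ a * MvPolynomial.X 1 ^ (b + 1)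
      * (MvPolynomial.X 2 - MvPolynomial.C (1 / 2) * MvPolynomial.X 1) ^ (k - 1)))
      = instantiate (ellipticRule C k).P (expVec a b k) := by
  have ek : tPow C (2 : Fin 3) (-(k : ℤ) + 1) = tPow C 2 (-1) ^ (k - 1) := by
    rw [← tPow_natCast]
    congr 1
    push_cast [hk]
    ring
  have h0 := tPow_mul_tPow_neg (R := C) (0 : Fin 3) 1
  have h2 := tPow_mul_tPow_neg (R := C) (2 : Fin 3) 1
  have hC : toLaurent C (MvPolynomial.C (1 / 2) : MvPolynomial (Fin 3) C)
      = algebraMap C (Laurent 3 C) (1 / 2) := MvPolynomial.aeval_C _ _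
  have htwo : (2 : Laurent 3 C) * algebraMap C (Laurent 3 C) (1 / 2) = 1 := by
    rw [← map_ofNat (algebraMap C (Laurent 3 C)) 2, ← map_mul,
      mul_one_div_cancel two_ne_zero, map_one]
  rw [instantiate_eq]
  by_cases hk1 : k = 1
  · subst hk1
    obtain rfl : a = b + 1 := by omega
    have one : toLaurent C (1 : MvPolynomial (Fin 3) C) = 1 := map_one _
    simp only [ellipticRule, ellipticP, if_true, map_add, map_sub, mapRingHom_smul, map_mul,
      map_one, one, Derivation.leibniz, Derivation.leibniz_pow, ellipticDeriv_X, toLaurent_X,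
      map_pow, smul_eq_mul, nsmul_eq_mul, map_natCast, MvPolynomial.eval_X, expVec_zero,
      expVec_one, expVec_two, Matrix.cons_val, Nat.sub_self, pow_zero, mul_one,
      Nat.add_sub_cancel]
    push_cast
    ring
  · obtain ⟨m, rfl⟩ : ∃ m, k = m + 2 := ⟨k - 2, by omega⟩
    obtain rfl : b = a + m := by omega
    simp only [ellipticRule, ellipticP, if_neg hk1, ellipticS, ellipticT, map_add, map_sub,
      mapRingHom_smul, map_mul, mapRingHom_tPow, map_one, mul_zero, add_zero, ek,
      Derivation.leibniz, Derivation.leibniz_pow, ellipticDeriv_X, toLaurent_X, map_pow,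
      smul_eq_mul, nsmul_eq_mul, map_natCast, MvPolynomial.eval_X, MvPolynomial.eval_C,
      MvPolynomial.derivation_C, hC, expVec_zero, expVec_one, expVec_two, Matrix.cons_val,
      Nat.add_sub_cancel, show m + 2 - 1 = m + 1 by omega]
    have ha := natCast_mul_pow_pred h0 a
    generalize tPow C (0 : Fin 3) 1 = u0 at *
    generalize tPow C (1 : Fin 3) 1 = u1 at *
    generalize tPow C (2 : Fin 3) 1 = u2 at *
    generalize tPow C (0 : Fin 3) (-1) = v0 at *
    generalize tPow C (2 : Fin 3) (-1) = v2 at *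
    generalize algebraMap C (Laurent 3 C) (1 / 2) = t at *
    have h2' : u2 ^ (m + 1) * v2 ^ (m + 1) = 1 := by rw [← mul_pow, h2, one_pow]
    push_cast
    linear_combination ((u2 - t * u1) ^ (m + 1) * u1 ^ (a + m + 1) * (u0 * (1 - u0 ^ 2))) * ha
      + ((u2 - t * u1) ^ (m + 1) * u1 ^ (a + m + 1) * u0 ^ a * (1 - u0 ^ 2) * a) * h0
      - ((u2 - t * u1) ^ m * ((a + m + 1) * u2 - (t * a + m + 1) * u1) * u0 ^ a
        * u1 ^ (a + m) * u2) * h2'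
      + ((u2 - t * u1) ^ m * u0 ^ a * u1 ^ (a + m) * (m + 1)
        * ((1 - u0 ^ 2) * u1 ^ 2 - u1 * u2)) * htwo

end Identities

/-! ### The rules are reduction rules -/

/-- The generic rule asks for `x₁ - x₂ + x₃ ≠ 2`, the rule with index `k` for equality and
`x₃ = k`. -/
theorem ellipticSystem_exclusive {C : Type*} [Field C]
    {r r' : RuleTriple 3 C} (hr : r ∈ ellipticSystem C)
    (hr' : r' ∈ ellipticSystem C) {α : Fin 3 →₀ ℕ} (h : r.B α) (h' : r'.B α) : r = r' := by
  rcases hr with rfl | ⟨k, -, rfl⟩ <;> rcases hr' with rfl | ⟨k', -, rfl⟩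
  · rfl
  · obtain ⟨h1, h2⟩ := h
    obtain ⟨h3, h4, h5⟩ := h'
    omega
  · obtain ⟨h1, h2⟩ := h'
    obtain ⟨h3, h4, h5⟩ := h
    omega
  · rw [← h.1, ← h'.1]

section Rules

variable (C : Type*) [Field C] [CharZero C]

theorem isReductionRule_genericRule :
    IsReductionRule ellipticLT (ellipticDeriv C).toLinearMap (genericRule C) := by
  refine ⟨fun α hα => ?_, (leadsWith_genericRule C).isLaurentLM fun h => ?_, fun α hα => ?_⟩
  · obtain ⟨a, ha⟩ : ∃ a, α 0 = a + 2 := ⟨α 0 - 2, by have := hα.1; omega⟩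
    refine ⟨MvPolynomial.X 0 ^ a * MvPolynomial.X 1 ^ α 1 * MvPolynomial.X 2 ^ α 2, _, ?_, ?_, rfl⟩
    · have e : tPow C (0 : Fin 3) (-2) = tPow C 0 (-1) ^ 2 := by
        rw [← tPow_natCast]; norm_num
      have h : tPow C (0 : Fin 3) (-2) * tPow C 0 1 ^ 2 = 1 := by
        rw [e, ← mul_pow, mul_comm, tPow_mul_tPow_neg, one_pow]
      rw [instantiate_eq]
      simp only [genericRule, mapRingHom_tPow, map_mul, map_pow, toLaurent_X, ha]
      linear_combination (-tPow C (0 : Fin 3) 1 ^ a * tPow C 1 1 ^ α 1 * tPow C 2 1 ^ α 2) * h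
    · rw [← expVec_self α, ha]
      exact toLaurent_ellipticDeriv_monomial a (α 1) (α 2)
  · have := congrArg (MvPolynomial.eval (fun _ => (0 : C))) h
    simp only [map_neg, map_sub, map_add, MvPolynomial.eval_X, map_ofNat, map_zero] at this
    norm_num at this
  · rw [(leadsWith_genericRule C).coeff_eq]
    simp only [map_neg, map_sub, map_add, MvPolynomial.eval_X, map_ofNat, ne_eq, neg_eq_zero]
    intro h
    refine hα.2 ?_
    have : ((((α 0 : ℤ) - α 1 + α 2 : ℤ)) : C) = ((2 : ℤ) : C) := by
      push_cast
      linear_combination h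
    exact_mod_cast this

theorem isReductionRule_ellipticRule (k : ℕ) (hk : 1 ≤ k) :
    IsReductionRule ellipticLT (ellipticDeriv C).toLinearMap (ellipticRule C k) := by
  refine ⟨fun α hα => ?_, (leadsWith_ellipticP C k hk).isLaurentLM fun h => ?_, fun α hα => ?_⟩
  · obtain ⟨h2, h0, h1⟩ := hα
    refine ⟨MvPolynomial.X 0 ^ α 0 * MvPolynomial.X 1 ^ (α 1 + 1)
      * (MvPolynomial.X 2 - MvPolynomial.C (1 / 2) * MvPolynomial.X 1) ^ (k - 1), _, ?_, ?_, rfl⟩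
    · have hC : toLaurent C (MvPolynomial.C (1 / 2) : MvPolynomial (Fin 3) C)
          = algebraMap C (Laurent 3 C) (1 / 2) := MvPolynomial.aeval_C _ _
      have h : tPow C (2 : Fin 3) (-(k : ℤ)) * tPow C 2 1 ^ k = 1 := by
        rw [show -(k : ℤ) = k * (-1) by ring, tPow_natCast, ← mul_pow, mul_comm,
          tPow_mul_tPow_neg, one_pow]
      rw [instantiate_eq]
      simp only [ellipticRule, ellipticS, mapRingHom_tPow, mapRingHom_smul, map_mul, map_sub,
        map_pow, toLaurent_X, MvPolynomial.eval_C, h2, hC]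
      generalize algebraMap C (Laurent 3 C) (1 / 2) = t
      linear_combination (-tPow C (0 : Fin 3) 1 ^ α 0 * tPow C 1 1 ^ (α 1 + 1)
        * (tPow C 2 1 - t * tPow C 1 1) ^ (k - 1)) * h
    · have := toLaurent_ellipticDeriv_special (C := C) k (α 0) (α 1) hk (by omega)
      rw [← h2, expVec_self] at this
      rw [← h2]
      exact this
  · have := congrArg (MvPolynomial.eval 1) h
    simp at this
    omega
  · rw [show (ellipticRule C k).P = ellipticP C k from rfl,
      (leadsWith_ellipticP C k hk).coeff_eq]
    obtain ⟨h2, h0, h1⟩ := hα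
    simp only [map_sub, map_add, MvPolynomial.eval_X, map_natCast, map_one, ne_eq, sub_eq_zero]
    rw [← h2]
    exact_mod_cast h0

/-! ### Completeness -/

theorem isReductionRule_of_mem_ellipticSystem {r : RuleTriple 3 C} (hr : r ∈ ellipticSystem C) :
    IsReductionRule ellipticLT (ellipticDeriv C).toLinearMap r := by
  rcases hr with rfl | ⟨k, hk, rfl⟩
  · exact isReductionRule_genericRule C
  · exact isReductionRule_ellipticRule C k hk

theorem isPrecompleteSystem_ellipticSystem :
    IsPrecompleteSystem (ellipticDeriv C).toLinearMap (ellipticSystem C) := by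
  apply le_antisymm
  · rw [Submodule.span_le]
    rintro p ⟨r, hr, α, hα, hp⟩
    obtain ⟨q, p', -, hp', hL⟩ := (isReductionRule_of_mem_ellipticSystem C hr).1 α hα
    exact ⟨q, hL.trans (toLaurent_injective (hp'.trans hp.symm))⟩
  -- `W` consists of the polynomials whose derivative lies in the span of the rule instances.
  set V := Submodule.span C {p : MvPolynomial (Fin 3) C | ∃ r ∈ ellipticSystem C,
    ∃ α : Fin 3 →₀ ℕ, r.B α ∧ toLaurent C p = instantiate r.P α}
  let W : Submodule C (MvPolynomial (Fin 3) C) := V.comap (ellipticDeriv C).toLinearMap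
  have hW : ∀ f, f ∈ W ↔ ellipticDeriv C f ∈ V := fun f => Iff.rfl
  have hgen : ∀ a b c : ℕ, a + c ≠ b →
      MvPolynomial.X 0 ^ a * MvPolynomial.X 1 ^ b * MvPolynomial.X 2 ^ c ∈ W := by
    intro a b c h
    refine (hW _).2 (Submodule.subset_span ⟨genericRule C, Or.inl rfl, expVec (a + 2) b c, ?_,
      toLaurent_ellipticDeriv_monomial a b c⟩)
    refine ⟨by simp, ?_⟩
    simp only [expVec_zero, expVec_one, expVec_two]
    omega
  have hspec : ∀ a c : ℕ, MvPolynomial.X 0 ^ a * MvPolynomial.X 1 ^ (a + c)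
      * (MvPolynomial.X 2 - MvPolynomial.C (1 / 2) * MvPolynomial.X 1) ^ c ∈ W := by
    intro a c
    by_cases h : a + c = 0
    · obtain ⟨rfl, rfl⟩ : a = 0 ∧ c = 0 := by omega
      simp [hW]
    · obtain ⟨b, hb⟩ : ∃ b, a + c = b + 1 := ⟨a + c - 1, by omega⟩
      have h1 := toLaurent_ellipticDeriv_special (C := C) (c + 1) a b (by omega) (by omega)
      rw [Nat.add_sub_cancel, ← hb] at h1
      refine (hW _).2 (Submodule.subset_span ⟨ellipticRule C (c + 1),
        Or.inr ⟨c + 1, by omega, rfl⟩, expVec a b (c + 1), ?_, h1⟩)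
      refine ⟨by simp, ?_, ?_⟩
      · simp only [expVec_zero, expVec_two]
        omega
      · simp only [expVec_zero, expVec_one]
        omega
  -- In the binomial expansion of `hspec`, all terms except the one wanted are covered by `hgen`.
  have hdiag : ∀ a c : ℕ, MvPolynomial.X 0 ^ a * MvPolynomial.X 1 ^ (a + c)
      * MvPolynomial.X 2 ^ c ∈ W := by
    intro a c
    have h := hspec a c
    rw [sub_eq_add_neg, ← neg_mul, ← map_neg, add_pow, Finset.sum_range_succ, mul_add] at h
    simp only [Nat.sub_self, pow_zero, mul_one, Nat.choose_self, Nat.cast_one] at h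
    refine (Submodule.add_mem_iff_right W ?_).1 h
    rw [Finset.mul_sum]
    refine Submodule.sum_mem _ fun j hj => ?_
    have hj' := Finset.mem_range.1 hj
    have h2 := W.smul_mem ((-(1 / 2)) ^ (c - j) * (c.choose j : C))
      (hgen a (a + c + (c - j)) j (by omega))
    convert h2 using 1
    rw [MvPolynomial.smul_eq_C_mul]
    simp only [map_mul, map_pow, map_natCast]
    ring
  rintro _ ⟨f, rfl⟩
  change f ∈ W
  rw [f.as_sum]
  refine Submodule.sum_mem _ fun α _ => ?_
  rw [monomial_eq_X_pow]
  refine W.smul_mem _ ?_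
  by_cases h : α 0 + α 2 = α 1
  · rw [← h]
    exact hdiag _ _
  · exact hgen _ _ _ h

theorem isCompleteReductionSystem_ellipticSystem :
    IsCompleteReductionSystem ellipticLT (ellipticDeriv C).toLinearMap (ellipticSystem C) :=
  isCompleteReductionSystem_of_exclusive ellipticLT_isSemigroupOrder
    (fun _ hr => isReductionRule_of_mem_ellipticSystem C hr)
    (isPrecompleteSystem_ellipticSystem C)
    (fun _ hr _ hr' _ h h' => ellipticSystem_exclusive hr hr' h h')

end Rules

/-! ### Homogeneity -/

/-- A derivation that maps each variable to an element of the same weight preserves weighted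
homogeneity. -/
theorem MvPolynomial.IsWeightedHomogeneous.derivation {σ R : Type*} [CommRing R] {w : σ → ℕ}
    (D : Derivation R (MvPolynomial σ R) (MvPolynomial σ R))
    (hD : ∀ i, IsWeightedHomogeneous w (D (X i)) (w i)) {u : MvPolynomial σ R} {d : ℕ}
    (hu : IsWeightedHomogeneous w u d) : IsWeightedHomogeneous w (D u) d := by
  have e : D = mkDerivation R fun i => D (X i) := derivation_ext fun i => by simp
  rw [u.as_sum, map_sum]
  refine IsWeightedHomogeneous.sum _ _ _ fun α hα => ?_
  rw [e, mkDerivation_monomial]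
  refine (weightedHomogeneousSubmodule R w d).smul_mem _ (Submodule.sum_mem _ fun i hi => ?_)
  rw [mem_weightedHomogeneousSubmodule]
  simp only [smul_eq_mul]
  have hα' : Finsupp.weight w α = d := hu (mem_support_iff.1 hα)
  have hsplit : α - Finsupp.single i 1 + Finsupp.single i 1 = α :=
    tsub_add_cancel_of_le (by
      simpa [Nat.one_le_iff_ne_zero] using Finsupp.mem_support_iff.1 hi)
  rw [← hα', ← hsplit, map_add]
  simp only [Finsupp.weight_single, one_smul, hsplit]
  exact (isWeightedHomogeneous_monomial _ _ _ rfl).mul (hD i)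

theorem isWeightedHomogeneous_ellipticDeriv {C : Type*} [Field C] {u : MvPolynomial (Fin 3) C}
    {d : ℕ} (hu : MvPolynomial.IsWeightedHomogeneous ![0, 1, 1] u d) :
    MvPolynomial.IsWeightedHomogeneous ![0, 1, 1] (ellipticDeriv C u) d := by
  have hX := MvPolynomial.isWeightedHomogeneous_X C (![0, 1, 1] : Fin 3 → ℕ)
  have h1 : MvPolynomial.IsWeightedHomogeneous (![0, 1, 1] : Fin 3 → ℕ)
      (1 - MvPolynomial.X 0 ^ 2 : MvPolynomial (Fin 3) C) 0 := by
    simpa using (MvPolynomial.isWeightedHomogeneous_one C _).sub ((hX 0).pow 2)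
  refine hu.derivation _ fun i => ?_
  rw [ellipticDeriv_X]
  fin_cases i
  · simpa using (hX 0).mul h1
  · simpa using (hX 2).sub (by simpa using h1.mul (hX 1))
  · simpa using h1.mul ((hX 2).sub (hX 1))

/-! ### Counting the irreducible monomials -/

/-- In weighted degree `d = α 1 + α 2`, the irreducible monomials are `t₁^(d+2) t₂^d` and those of
`t₁`-degree at most `1`, except for the one reduced by the rule with index `d / 2 + 1`. -/
theorem not_reduces_iff {C : Type*} [Field C] (α : Fin 3 →₀ ℕ) :
    (¬ (genericRule C).Reduces α ∧ ∀ k : ℕ, 1 ≤ k → ¬ (ellipticRule C k).Reduces α) ↔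
      (α 2 = 0 ∧ α 0 = α 1 + 2) ∨
      (α 0 < 2 ∧ ¬ (α 0 = (α 1 + α 2) % 2 ∧ α 2 = (α 1 + α 2) / 2 + 1)) := by
  have h1 : (genericRule C).Reduces α ↔ 2 ≤ α 0 ∧ (α 0 : ℤ) - α 1 + α 2 ≠ 2 := Iff.rfl
  have h2 : (∃ k : ℕ, 1 ≤ k ∧ (ellipticRule C k).Reduces α) ↔
      1 ≤ α 2 ∧ α 0 + α 2 ≠ 1 ∧ (α 1 : ℤ) = α 0 + α 2 - 2 := by
    constructor
    · rintro ⟨k, hk, rfl, h⟩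
      exact ⟨hk, h⟩
    · rintro ⟨hk, h⟩
      exact ⟨α 2, hk, rfl, h⟩
  have h3 : (∀ k : ℕ, 1 ≤ k → ¬ (ellipticRule C k).Reduces α) ↔
      ¬ ∃ k : ℕ, 1 ≤ k ∧ (ellipticRule C k).Reduces α := by
    push Not
    rfl
  rw [h3, h1, h2]
  omega

theorem ncard_irreducible (C : Type*) [Field C] (d : ℕ) :
    {α : Fin 3 →₀ ℕ | Finsupp.weight (![0, 1, 1] : Fin 3 → ℕ) α = d ∧
        ¬ (genericRule C).Reduces α ∧
        ∀ k : ℕ, 1 ≤ k → ¬ (ellipticRule C k).Reduces α}.ncard = max 3 (2 * d + 2) := by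
  -- The exponents of `t₁` and `t₃`; for `d = 0` the erased pair is not in the product.
  let F : Finset (ℕ × ℕ) := insert (d + 2, 0)
    ((Finset.range 2 ×ˢ Finset.range (d + 1)).erase (d % 2, d / 2 + 1))
  have hw : ∀ α : Fin 3 →₀ ℕ, Finsupp.weight (![0, 1, 1] : Fin 3 → ℕ) α = α 1 + α 2 := by
    intro α
    simp [Finsupp.weight_apply, Finsupp.sum_fintype, Fin.sum_univ_three]
  have hset : {α : Fin 3 →₀ ℕ | Finsupp.weight (![0, 1, 1] : Fin 3 → ℕ) α = d ∧
        ¬ (genericRule C).Reduces α ∧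
        ∀ k : ℕ, 1 ≤ k → ¬ (ellipticRule C k).Reduces α}
      = (fun p : ℕ × ℕ => expVec p.1 (d - p.2) p.2) '' F := by
    ext α
    simp only [Set.mem_ofPred_eq, hw, not_reduces_iff, Set.mem_image, SetLike.mem_coe, Prod.exists,
      F, Finset.mem_insert, Finset.mem_erase, Finset.mem_product, Finset.mem_range, Prod.mk.injEq,
      ne_eq]
    constructor
    · rintro ⟨rfl, h⟩
      refine ⟨α 0, α 2, by omega, ?_⟩
      rw [Nat.add_sub_cancel, expVec_self]
    · rintro ⟨i, k, h, rfl⟩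
      simp only [expVec_zero, expVec_one, expVec_two]
      have : d - k + k = d := by omega
      rw [this]
      omega
  have hinj : Set.InjOn (fun p : ℕ × ℕ => expVec p.1 (d - p.2) p.2) F := by
    intro p _ q _ h
    exact Prod.ext (DFunLike.congr_fun h 0) (DFunLike.congr_fun h 2)
  rw [hset, hinj.ncard_image, Set.ncard_coe_finset, Finset.card_insert_of_notMem]
  · rcases Nat.eq_zero_or_pos d with rfl | hd
    · rfl
    · rw [Finset.card_erase_of_mem, Finset.card_product, Finset.card_range, Finset.card_range]
      · omega
      · simp only [Finset.mem_product, Finset.mem_range]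
        omega
  · simp

/-! ### The complete reduction system -/

theorem mainTheorem9 (C : Type*) [Field C] [CharZero C] :
    -- the generic rule and the rules `(P_k, Q_k, B_k)` are reduction rules
    IsReductionRule ellipticLT (ellipticDeriv C).toLinearMap (genericRule C) ∧
    (∀ k : ℕ, 1 ≤ k →
      IsReductionRule ellipticLT (ellipticDeriv C).toLinearMap (ellipticRule C k)) ∧
    -- together they form a complete reduction system
    IsCompleteReductionSystem ellipticLT (ellipticDeriv C).toLinearMap (ellipticSystem C) ∧
    -- a monomial reducible by none of them is not a leading monomial of an element of the image
    (∀ α : Fin 3 →₀ ℕ, ¬ (genericRule C).Reduces α →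
      (∀ k : ℕ, 1 ≤ k → ¬ (ellipticRule C k).Reduces α) →
      ∀ u : MvPolynomial (Fin 3) C, ¬ IsLM ellipticLT (ellipticDeriv C u) α) ∧
    -- the derivation preserves homogeneity with respect to the weights `(0, 1, 1)`
    (∀ (u : MvPolynomial (Fin 3) C) (d : ℕ),
      MvPolynomial.IsWeightedHomogeneous ![0, 1, 1] u d →
      MvPolynomial.IsWeightedHomogeneous ![0, 1, 1] (ellipticDeriv C u) d) ∧
    -- number of irreducible monomials of weighted degree `d`
    (∀ d : ℕ, {α : Fin 3 →₀ ℕ | Finsupp.weight (![0, 1, 1] : Fin 3 → ℕ) α = d ∧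
        ¬ (genericRule C).Reduces α ∧
        ∀ k : ℕ, 1 ≤ k → ¬ (ellipticRule C k).Reduces α}.ncard = max 3 (2 * d + 2)) := by
  have hcomplete := isCompleteReductionSystem_ellipticSystem C
  refine ⟨isReductionRule_genericRule C, isReductionRule_ellipticRule C, hcomplete,
    fun α h0 hk u hu => ?_, fun u d hu => isWeightedHomogeneous_ellipticDeriv hu,
    ncard_irreducible C⟩
  have hne : ellipticDeriv C u ≠ 0 := fun h => hu.1 (by simp [h])
  obtain ⟨β, hβ, r, hr, hred⟩ := hcomplete.2.2 _ ⟨u, rfl⟩ hne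
  rw [IsLM.unique ellipticLT_isSemigroupOrder hβ hu] at hred
  rcases hr with rfl | ⟨k, hk1, rfl⟩
  · exact h0 hred
  · exact hk k hk1 hred
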